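/- Let $\Bbbk$ be a unital commutative ring and let $n \geq 1$ and $d \geq 2$ be integers. Let $NC_A(n,d) := NC_{A_n}((2,\dots,2,d))$ be the generalized nil-Coxeter algebra of type $A_n$, i.e. the associative unital $\Bbbk$-algebra generated by $T_1,\dots,T_n$ subject to the relations $$T_iT_{i+1}T_i = T_{i+1}T_iT_{i+1}\ (0<i<n),\qquad T_iT_j=T_jT_i\ (|i-j|>1),\qquad T_1^2=\cdots=T_{n-1}^2=T_n^d=0.$$ For $w$ in the symmetric group $S_n$, with simple transpositions $s_i=(i\ \,i+1)$, $1\le i\le n-1$, put $T_w := T_{i_1}\cdots T_{i_r}$, where $w=s_{i_1}\cdots s_{i_r}$ is a reduced expression; this does not depend on the reduced expression. Then $NC_A(n,d)$ is a free $\Bbbk$-module, with $\Bbbk$-basis consisting of the $n!\,(1+n(d-1))$ elements $$\{T_w : w\in S_n\}\ \sqcup\ \{T_w\,T_n^k\,T_{n-1}T_{n-2}\cdots T_{m+1}T_m : w\in S_n,\ 1\le k\le d-1,\ 1\le m\le n\}$$ (where $T_{n-1}\cdots T_m$ is the empty product $1$ if $m=n$). In particular, if $\Bbbk \neq 0$,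 it has rank $n!\,(1+n(d-1))$. Moreover, for every integer $l$ with $1\le l\le n-1$, the subalgebra $R_l$ generated by $T_1,\dots,T_l$ is isomorphic to the usual nil-Coxeter algebra $NC_{A_l}((2,\dots,2))$ (the unital $\Bbbk$-algebra generated by $T_1,\dots,T_l$ with the braid relations of type $A_l$ and $T_1^2=\cdots=T_l^2=0$), by an isomorphism that sends each generator $T_i$ to $T_i$. -/

import Mathlib

namespace NilCoxeter

section Algebra

variable (k : Type*) [CommRing k] {I : Type*}

/-- The monomial `T_{i₁} T_{i₂} ⋯` in the free associative `k`-algebra on `I`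
attached to the word `[i₁, i₂, …]`. -/
def freeMonomial (ω : List I) : FreeAlgebra k I :=
  (ω.map (FreeAlgebra.ι k)).prod

/-- The defining relations of the generalized nil-Coxeter algebra. The generalized Coxeter matrix
is given by its off-diagonal part (that of the Coxeter matrix `M`, where Mathlib writes the
entry `∞` as `0`) and by its diagonal `d`.
The word `CoxeterSystem.braidWord M i j` alternates between `i` and `j` and has
exactly `M i j` letters; if `M i j = 0` (that is, `m_{ij} = ∞`) both words are empty, so that
no relation is imposed, and there is none for `i = j` either. -/
inductive Rel (M : CoxeterMatrix I) (d : I → ℕ) : FreeAlgebra k I → FreeAlgebra k I → Prop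
  | braid (i j : I) :
      Rel M d (freeMonomial k (CoxeterSystem.braidWord M i j))
        (freeMonomial k (CoxeterSystem.braidWord M j i))
  | order (i : I) : Rel M d (FreeAlgebra.ι k i ^ d i) 0

/-- The generalized nil-Coxeter algebra `NC_M(d)` over `k`: the quotient of the free associative
algebra on `T_i`, `i ∈ I`, by the braid relations of `M` and the relations `T_i ^ (d i) = 0`. -/
abbrev NC (M : CoxeterMatrix I) (d : I → ℕ) : Type _ := RingQuot (Rel k M d)

/-- The generator `T_i` of `NC_M(d)`. -/
def T (M : CoxeterMatrix I) (d : I → ℕ) (i : I) : NC k M d :=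
  RingQuot.mkAlgHom k (Rel k M d) (FreeAlgebra.ι k i)

end Algebra

section TypeA

/-- The vector `(2, …, 2, d)` with `n` entries. -/
def dVec (n d : ℕ) (i : Fin n) : ℕ := if i.val + 1 = n then d else 2

variable (k : Type*) [CommRing k]

/-- `NC_A(n,d) = NC_{A_n}((2, …, 2, d))`. Its generators `T_1, …, T_n` are indexed by `Fin n`,
the index `i : Fin n` standing for `T_{i+1}`. -/
abbrev NCA (n d : ℕ) : Type _ := NC k (CoxeterMatrix.A n) (dVec n d)

/-- The generator `T_{i+1}` of `NC_A(n,d)`. -/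
abbrev TA (n d : ℕ) (i : Fin n) : NCA k n d := T k (CoxeterMatrix.A n) (dVec n d) i

/-- The usual nil-Coxeter algebra of type `A_l`, `NC_{A_l}((2, …, 2))`. -/
abbrev UsualNCA (l : ℕ) : Type _ := NC k (CoxeterMatrix.A l) (fun _ => 2)

/-- The explicit relations `T_i T_{i+1} T_i = T_{i+1} T_i T_{i+1}`, `T_i T_j = T_j T_i` for
`|i - j| > 1`, `T_1^2 = ⋯ = T_{n-1}^2 = 0` and `T_n^d = 0`. -/
inductive ExplicitRel (n d : ℕ) : FreeAlgebra k (Fin n) → FreeAlgebra k (Fin n) → Prop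
  | braid (i j : Fin n) (h : i.val + 1 = j.val) :
      ExplicitRel n d
        (FreeAlgebra.ι k i * FreeAlgebra.ι k j * FreeAlgebra.ι k i)
        (FreeAlgebra.ι k j * FreeAlgebra.ι k i * FreeAlgebra.ι k j)
  | comm (i j : Fin n) (h : 1 < |(i.val : ℤ) - (j.val : ℤ)|) :
      ExplicitRel n d
        (FreeAlgebra.ι k i * FreeAlgebra.ι k j) (FreeAlgebra.ι k j * FreeAlgebra.ι k i)
  | sq (i : Fin n) (h : i.val + 1 < n) : ExplicitRel n d (FreeAlgebra.ι k i ^ 2) 0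
  | pow (i : Fin n) (h : i.val + 1 = n) : ExplicitRel n d (FreeAlgebra.ι k i ^ d) 0

end TypeA

section SymmetricGroup

/-- The simple transposition in `S_n` exchanging the `i`-th and the next element of `Fin n`. -/
def simpleTransposition (n : ℕ) (i : Fin (n - 1)) : Equiv.Perm (Fin n) :=
  Equiv.swap ⟨i.val, by omega⟩ ⟨i.val + 1, by omega⟩

/-- The product in `S_n` of a word in the simple transpositions. -/
def permOfWord (n : ℕ) (ω : List (Fin (n - 1))) : Equiv.Perm (Fin n) :=
  (ω.map (simpleTransposition n)).prod

/-- `ω` is a reduced word for `w ∈ S_n`: a word of minimal length among those with product `w`. -/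
def IsReducedWord {n : ℕ} (w : Equiv.Perm (Fin n)) (ω : List (Fin (n - 1))) : Prop :=
  permOfWord n ω = w ∧ ∀ ω' : List (Fin (n - 1)), permOfWord n ω' = w → ω.length ≤ ω'.length

theorem exists_permOfWord {n : ℕ} (w : Equiv.Perm (Fin n)) : ∃ ω, permOfWord n ω = w := by
  cases n with
  | zero => exact ⟨[], Subsingleton.elim _ _⟩
  | succ n =>
    have hw : w ∈ Submonoid.closure (Set.range (simpleTransposition (n + 1))) := by
      have h := Equiv.Perm.mclosure_swap_castSucc_succ n
      have h2 : Set.range (simpleTransposition (n + 1)) =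
          Set.range fun i : Fin n => Equiv.swap i.castSucc i.succ := rfl
      rw [h2, h]
      trivial
    induction hw using Submonoid.closure_induction with
    | mem x hx =>
      obtain ⟨i, rfl⟩ := hx
      exact ⟨[i], by simp [permOfWord]⟩
    | one => exact ⟨[], by simp [permOfWord]⟩
    | mul x y _ _ hx hy =>
      obtain ⟨a, rfl⟩ := hx
      obtain ⟨b, rfl⟩ := hy
      exact ⟨a ++ b, by simp [permOfWord]⟩

theorem exists_isReducedWord {n : ℕ} (w : Equiv.Perm (Fin n)) : ∃ ω, IsReducedWord w ω := by
  classical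
  have h : ∃ r, ∃ ω, permOfWord n ω = w ∧ ω.length = r := by
    obtain ⟨ω, hω⟩ := exists_permOfWord w
    exact ⟨_, ω, hω, rfl⟩
  obtain ⟨ω, hω, hr⟩ := Nat.find_spec h
  exact ⟨ω, hω, fun ω' h' => hr.le.trans (Nat.find_min' h ⟨ω', h', rfl⟩)⟩

end SymmetricGroup

section Words

variable (k : Type*) [CommRing k]

/-- The product in `NC_A(n,d)` of a word in the letters `T_1, …, T_{n-1}`. -/
def wordA (n d : ℕ) (ω : List (Fin (n - 1))) : NCA k n d :=
  (ω.map fun i => TA k n d (i.castLE (Nat.sub_le n 1))).prod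

/-- The element `T_w` of `NC_A(n,d)` for `w ∈ S_n`: the product of the letters of a reduced word
of `w`. -/
noncomputable def TW (n d : ℕ) (w : Equiv.Perm (Fin n)) : NCA k n d :=
  wordA k n d (exists_isReducedWord w).choose

/-- The product `T_{n-1} T_{n-2} ⋯ T_m` in `NC_A(n,d)`, with `m - 1 ∈ Fin n` as the argument;
it is the empty product `1` for `m = n`. -/
def descA (n d : ℕ) (m : Fin n) : NCA k n d :=
  (((List.finRange n).filter fun j => m ≤ j ∧ j.val + 1 < n).reverse.map (TA k n d)).prod

/-- Index set of the standard words: `Sum.inl w` stands for `T_w`, and `Sum.inr (w, a, b)` for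
`T_w T_n^k T_{n-1} ⋯ T_m` with `k = a + 1 ∈ [1, d-1]` and `m = b + 1 ∈ [1, n]`. -/
abbrev StdIndex (n d : ℕ) : Type :=
  Equiv.Perm (Fin n) ⊕ (Equiv.Perm (Fin n) × Fin (d - 1) × Fin n)

/-- The standard words `T_w` and `T_w T_n^k T_{n-1} ⋯ T_m` in `NC_A(n,d)`. -/
noncomputable def stdWord (n d : ℕ) (hn : 1 ≤ n) : StdIndex n d → NCA k n d
  | Sum.inl w => TW k n d w
  | Sum.inr (w, a, b) =>
      TW k n d w * TA k n d ⟨n - 1, by omega⟩ ^ (a.val + 1) * descA k n d b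

/-- The subalgebra `R_l` of `NC_A(n,d)` generated by `T_1, …, T_l`. -/
def R (n d l : ℕ) : Subalgebra k (NCA k n d) :=
  Algebra.adjoin k {x | ∃ i : Fin n, i.val < l ∧ TA k n d i = x}

end Words

end NilCoxeter

/-! Write `D_m` for `T_{n-1} ⋯ T_m`. The standard words span because their span contains 1 and is
stable under right multiplication by generators (`span_stdWord`). A letter below `T_n` extends
`D_m`, is killed by it, or slides left through it (with index possibly lowered by one), past
`T_n^k`, into the subalgebra of `T_1, …, T_{n-1}`, which the `T_w` span. The letter `T_n` raises the
exponent if `D_m = 1`; otherwise `T_n D_m T_n = T_{n-1} T_n D_m`, and `T_n^k D_m T_n = 0` for `k ≥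
2`.

Independence comes from a concrete partial right action on arrangements `0, …, n-1, ∞, ∞, …`
carrying an exponent. A letter below the last swaps increasing neighbours and kills everything else,
so `T_w` writes down `w`. The first `T_n` pulls an `∞` to position `n-1`, further powers only raise
the exponent, and `D_m` moves this `∞` left. Two finite neighbours may be swapped by the last letter
only while the exponent is 1, reflecting the vanishing above. `act_braid`, `act_comm`, `act_sq` and
`act_pow_none` check the relations; `coord_stdWord` and `stdState_injective` send the standard words
to distinct basis vectors, over any ring.

That the `T_w` are well defined is Matsumoto's theorem, proved as `IsAscendingWord.prod_eq`. The
same model separates the words spanning the usual nil-Coxeter algebra, which identifies it with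
`R_l`. -/

namespace NilCoxeter

/-! ### Braid relations of type A -/

section Braided

/-- The braid relations of type `A_m` for a family of elements of a monoid. -/
structure IsBraided {A : Type*} [Monoid A] {m : ℕ} (t : Fin m → A) : Prop where
  braid : ∀ i j : Fin m, i.val + 1 = j.val → t i * t j * t i = t j * t i * t j
  comm : ∀ i j : Fin m, i.val + 1 < j.val → t i * t j = t j * t i

theorem A_apply_adj {m : ℕ} {i j : Fin m} (h : i.val + 1 = j.val) :
    CoxeterMatrix.A m i j = 3 ∧ CoxeterMatrix.A m j i = 3 := by
  have h1 : i ≠ j := by intro h'; subst h'; omega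
  constructor <;> simp [CoxeterMatrix.A, h, h1, h1.symm]

theorem A_apply_far {m : ℕ} {i j : Fin m} (h : i.val + 1 < j.val) :
    CoxeterMatrix.A m i j = 2 ∧ CoxeterMatrix.A m j i = 2 := by
  have h1 : i ≠ j := by intro h'; subst h'; omega
  have h2 : ¬ (i.val + 1 = j.val) := by omega
  have h3 : ¬ (j.val + 1 = i.val) := by omega
  constructor <;> simp [CoxeterMatrix.A, h1, h1.symm, h2, h3]

theorem isBraided_iff_braidWord {A : Type*} [Monoid A] {m : ℕ} (t : Fin m → A) :
    IsBraided t ↔ ∀ i j : Fin m,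
      ((CoxeterSystem.braidWord (CoxeterMatrix.A m) i j).map t).prod =
        ((CoxeterSystem.braidWord (CoxeterMatrix.A m) j i).map t).prod := by
  -- An alternating word ends in its second letter, so the word of length three for `i j` starts
  -- with `j`, the one of length two with `i`.
  have adj : ∀ i j : Fin m, i.val + 1 = j.val →
      (((CoxeterSystem.braidWord (CoxeterMatrix.A m) i j).map t).prod = t j * t i * t j ∧
        ((CoxeterSystem.braidWord (CoxeterMatrix.A m) j i).map t).prod = t i * t j * t i) := by
    intro i j h
    simp [CoxeterSystem.braidWord, A_apply_adj h, CoxeterSystem.alternatingWord, mul_assoc]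
  have far : ∀ i j : Fin m, i.val + 1 < j.val →
      (((CoxeterSystem.braidWord (CoxeterMatrix.A m) i j).map t).prod = t i * t j ∧
        ((CoxeterSystem.braidWord (CoxeterMatrix.A m) j i).map t).prod = t j * t i) := by
    intro i j h
    simp [CoxeterSystem.braidWord, A_apply_far h, CoxeterSystem.alternatingWord]
  constructor
  · intro ht i j
    have key : ∀ i j : Fin m, i.val < j.val →
        ((CoxeterSystem.braidWord (CoxeterMatrix.A m) i j).map t).prod =
          ((CoxeterSystem.braidWord (CoxeterMatrix.A m) j i).map t).prod := by
      intro i j h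
      rcases (Nat.succ_le_of_lt h).eq_or_lt with h | h
      · rw [(adj i j h).1, (adj i j h).2, ht.braid i j h]
      · rw [(far i j h).1, (far i j h).2, ht.comm i j h]
    rcases lt_trichotomy i.val j.val with h | h | h
    · exact key i j h
    · rw [Fin.ext h]
    · exact (key j i h).symm
  · intro H
    refine ⟨fun i j h => ?_, fun i j h => ?_⟩
    · rw [← (adj i j h).1, ← (adj i j h).2, H]
    · rw [← (far i j h).1, ← (far i j h).2, H]

end Braided

/-! ### Universal property and explicit presentation -/

section Presentation

variable (k : Type*) [CommRing k]

theorem lift_freeMonomial {I A : Type*} [Semiring A] [Algebra k A] (t : I → A) (ω : List I) :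
    FreeAlgebra.lift k t (freeMonomial k ω) = (ω.map t).prod := by
  simp [freeMonomial, map_list_prod, List.map_map, Function.comp_def]

theorem mkAlgHom_freeMonomial {I : Type*} (M : CoxeterMatrix I) (d : I → ℕ) (ω : List I) :
    RingQuot.mkAlgHom k (Rel k M d) (freeMonomial k ω) = (ω.map (T k M d)).prod := by
  simp only [freeMonomial, map_list_prod, List.map_map]
  rfl

theorem isBraided_T (m : ℕ) (d : Fin m → ℕ) : IsBraided (T k (CoxeterMatrix.A m) d) := by
  rw [isBraided_iff_braidWord]
  intro i j
  rw [← mkAlgHom_freeMonomial, ← mkAlgHom_freeMonomial]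
  exact RingQuot.mkAlgHom_rel k (Rel.braid i j)

theorem T_pow {I : Type*} (M : CoxeterMatrix I) (d : I → ℕ) (i : I) : T k M d i ^ d i = 0 := by
  rw [T, ← map_pow, RingQuot.mkAlgHom_rel k (Rel.order i), map_zero]

theorem adjoin_range_T {I : Type*} (M : CoxeterMatrix I) (d : I → ℕ) :
    Algebra.adjoin k (Set.range (T k M d)) = ⊤ := by
  have h : Set.range (T k M d) =
      RingQuot.mkAlgHom k (Rel k M d) '' Set.range (FreeAlgebra.ι k) := by
    rw [← Set.range_comp]; rfl
  rw [h, ← AlgHom.map_adjoin, FreeAlgebra.adjoin_range_ι, Algebra.map_top,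
    AlgHom.range_eq_top]
  exact RingQuot.mkAlgHom_surjective k _

/-- The universal property of the generalized nil-Coxeter algebra of type `A_m`. -/
noncomputable def liftA {A : Type*} [Semiring A] [Algebra k A] {m : ℕ} {d : Fin m → ℕ} (t : Fin m → A)
    (ht : IsBraided t) (hd : ∀ i, t i ^ d i = 0) : NC k (CoxeterMatrix.A m) d →ₐ[k] A :=
  RingQuot.liftAlgHom k ⟨FreeAlgebra.lift k t, by
    rintro x y (⟨i, j⟩ | ⟨i⟩)
    · rw [lift_freeMonomial, lift_freeMonomial]
      exact (isBraided_iff_braidWord t).1 ht i j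
    · simp [hd]⟩

theorem liftA_T {A : Type*} [Semiring A] [Algebra k A] {m : ℕ} {d : Fin m → ℕ} (t : Fin m → A)
    (ht : IsBraided t) (hd : ∀ i, t i ^ d i = 0) (i : Fin m) :
    liftA k t ht hd (T k (CoxeterMatrix.A m) d i) = t i := by
  simp [liftA, T]

theorem TA_sq {n d : ℕ} (i : Fin n) (h : i.val + 1 < n) : TA k n d i ^ 2 = 0 := by
  have := T_pow k (CoxeterMatrix.A n) (dVec n d) i
  rwa [dVec, if_neg h.ne] at this

theorem TA_pow {n d : ℕ} (i : Fin n) (h : i.val + 1 = n) : TA k n d i ^ d = 0 := by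
  have := T_pow k (CoxeterMatrix.A n) (dVec n d) i
  rwa [dVec, if_pos h] at this

theorem exists_explicit_presentation (n d : ℕ) :
    ∃ e : NCA k n d ≃ₐ[k] RingQuot (ExplicitRel k n d),
      ∀ i : Fin n, e (TA k n d i) =
        RingQuot.mkAlgHom k (ExplicitRel k n d) (FreeAlgebra.ι k i) := by
  set q := RingQuot.mkAlgHom k (ExplicitRel k n d) with hq
  have hb : IsBraided fun i => q (FreeAlgebra.ι k i) := by
    refine ⟨fun i j h => ?_, fun i j h => ?_⟩
    · simp only [← map_mul]
      exact RingQuot.mkAlgHom_rel k (ExplicitRel.braid i j h)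
    · simp only [← map_mul]
      exact RingQuot.mkAlgHom_rel k (ExplicitRel.comm i j (by rw [lt_abs]; omega))
  have hd : ∀ i, q (FreeAlgebra.ι k i) ^ dVec n d i = 0 := by
    intro i
    rw [dVec, ← map_pow]
    split_ifs with h
    · rw [hq, RingQuot.mkAlgHom_rel k (ExplicitRel.pow i h), map_zero]
    · rw [hq, RingQuot.mkAlgHom_rel k (ExplicitRel.sq i (by omega)), map_zero]
  have hT := isBraided_T k n (dVec n d)
  let g : RingQuot (ExplicitRel k n d) →ₐ[k] NCA k n d :=
    RingQuot.liftAlgHom k ⟨FreeAlgebra.lift k (TA k n d), by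
      rintro x y (⟨i, j, h⟩ | ⟨i, j, h⟩ | ⟨i, h⟩ | ⟨i, h⟩)
      · simpa using hT.braid i j h
      · simp only [map_mul, FreeAlgebra.lift_ι_apply]
        rw [lt_abs] at h
        rcases h with h | h
        · exact (hT.comm j i (by omega)).symm
        · exact hT.comm i j (by omega)
      · simpa using TA_sq k i h
      · simpa using TA_pow k i h⟩
  have hg : ∀ i, g (q (FreeAlgebra.ι k i)) = TA k n d i := by
    intro i; simp [g, hq]
  refine ⟨AlgEquiv.ofAlgHom (liftA k _ hb hd) g ?_ ?_, fun i => liftA_T k _ hb hd i⟩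
  · apply RingQuot.ringQuot_ext'
    ext i
    change liftA k _ hb hd (g (q (FreeAlgebra.ι k i))) = q (FreeAlgebra.ι k i)
    rw [hg, liftA_T]
  · apply RingQuot.ringQuot_ext'
    ext i
    change g (liftA k _ hb hd (TA k n d i)) = TA k n d i
    rw [liftA_T, hg]

end Presentation

/-! ### Matsumoto's theorem for the symmetric group -/

section Ascending

variable {m : ℕ}

/-- `ω` is a word with product `w` each letter of which creates an inversion. -/
inductive IsAscendingWord : List (Fin m) → Equiv.Perm (Fin (m + 1)) → Prop
  | nil : IsAscendingWord [] 1
  | snoc {ω : List (Fin m)} {w : Equiv.Perm (Fin (m + 1))} {i : Fin m} (h : IsAscendingWord ω w)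
      (hi : w i.castSucc < w i.succ) :
      IsAscendingWord (ω ++ [i]) (w * Equiv.swap i.castSucc i.succ)

theorem IsAscendingWord.snoc_eq {ω : List (Fin m)} {w v : Equiv.Perm (Fin (m + 1))} {i : Fin m}
    (h : IsAscendingWord ω w) (hi : w i.castSucc < w i.succ)
    (hv : w * Equiv.swap i.castSucc i.succ = v) : IsAscendingWord (ω ++ [i]) v :=
  hv ▸ h.snoc hi

/-- Removing a descent makes the one-line notation lexicographically smaller; this replaces
induction on length. -/
theorem perm_lex_induction {P : Equiv.Perm (Fin (m + 1)) → Prop}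
    (H : ∀ w, (∀ i : Fin m, w i.succ < w i.castSucc →
      P (w * Equiv.swap i.castSucc i.succ)) → P w) (w : Equiv.Perm (Fin (m + 1))) : P w := by
  have wf : WellFounded fun v w : Equiv.Perm (Fin (m + 1)) =>
      toLex (v : Fin (m + 1) → Fin (m + 1)) < toLex (w : Fin (m + 1) → Fin (m + 1)) :=
    InvImage.wf (fun w : Equiv.Perm (Fin (m + 1)) => toLex (w : Fin (m + 1) → Fin (m + 1)))
      wellFounded_lt
  induction w using wf.induction with
  | h w ih =>
    refine H w fun i hi => ih _ ?_
    exact Pi.lex_desc (Fin.castSucc_lt_succ (i := i)).le hi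

theorem eq_one_of_ascending (w : Equiv.Perm (Fin (m + 1)))
    (h : ∀ i : Fin m, w i.castSucc < w i.succ) : w = 1 := by
  have hw : StrictMono w := Fin.strictMono_iff_lt_succ.2 h
  ext1 i
  exact DFunLike.congr_fun (Subsingleton.elim (hw.orderIsoOfSurjective w w.surjective)
    (OrderIso.refl _)) i

theorem exists_isAscendingWord (w : Equiv.Perm (Fin (m + 1))) : ∃ ω, IsAscendingWord ω w := by
  induction w using perm_lex_induction with
  | H w ih =>
    by_cases h : ∀ i : Fin m, w i.castSucc < w i.succ
    · rw [eq_one_of_ascending w h]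
      exact ⟨[], .nil⟩
    · push Not at h
      obtain ⟨i, hi⟩ := h
      have hi' : w i.succ < w i.castSucc :=
        lt_of_le_of_ne hi fun h => (Fin.castSucc_lt_succ (i := i)).ne' (w.injective h)
      obtain ⟨ω, hω⟩ := ih i hi'
      exact ⟨ω ++ [i], hω.snoc_eq (by simpa using hi') (by simp [mul_assoc])⟩

theorem IsAscendingWord.permOfWord_eq {ω : List (Fin m)} {w : Equiv.Perm (Fin (m + 1))}
    (h : IsAscendingWord ω w) : permOfWord (m + 1) ω = w := by
  induction h with
  | nil => rfl
  | snoc h hi ih =>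
    rw [← ih]
    simp only [permOfWord, List.map_append, List.prod_append, List.map_cons, List.map_nil,
      List.prod_cons, List.prod_nil, mul_one]
    rfl

theorem swap_adj_far {i j : Fin m} (h : i.val + 1 < j.val) :
    Equiv.swap i.castSucc i.succ * Equiv.swap j.castSucc j.succ =
      Equiv.swap j.castSucc j.succ * Equiv.swap i.castSucc i.succ := by
  have hd : (Equiv.swap i.castSucc i.succ).Disjoint (Equiv.swap j.castSucc j.succ) := by
    intro x
    by_cases hx : x = i.castSucc ∨ x = i.succ
    · right
      apply Equiv.swap_apply_of_ne_of_ne <;> rcases hx with rfl | rfl <;>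
        simp [Fin.ext_iff] <;> omega
    · left
      push Not at hx
      exact Equiv.swap_apply_of_ne_of_ne hx.1 hx.2
  exact hd.commute

theorem swap_braid {α : Type*} [DecidableEq α] {x y z : α} (hxy : x ≠ y) (hxz : x ≠ z)
    (hyz : y ≠ z) :
    Equiv.swap x y * Equiv.swap y z * Equiv.swap x y =
      Equiv.swap y z * Equiv.swap x y * Equiv.swap y z := by
  rw [Equiv.swap_mul_swap_mul_swap hxy hxz, Equiv.swap_comm x y, Equiv.swap_comm y z,
    Equiv.swap_mul_swap_mul_swap hyz.symm hxz.symm, Equiv.swap_comm]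

/-- If the last letters `i`, `j` differ, both are descents of `w`. Stripping from `w` the longest
element generated by `s_i` and `s_j` leaves a permutation with a word `ν`; by induction both words
may be replaced by `ν` followed by the two sides of one braid relation. -/
theorem IsAscendingWord.prod_eq {A : Type*} [Monoid A] {t : Fin m → A} (ht : IsBraided t)
    {w : Equiv.Perm (Fin (m + 1))} :
    ∀ {ω ω' : List (Fin m)}, IsAscendingWord ω w → IsAscendingWord ω' w →
      (ω.map t).prod = (ω'.map t).prod := by
  induction w using perm_lex_induction with
  | H w ih =>
    have aux : ∀ {ω ω' : List (Fin m)} {i j : Fin m} {u u' : Equiv.Perm (Fin (m + 1))},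
        i.val < j.val → IsAscendingWord ω u → u i.castSucc < u i.succ →
        u * Equiv.swap i.castSucc i.succ = w → IsAscendingWord ω' u' →
        u' j.castSucc < u' j.succ → u' * Equiv.swap j.castSucc j.succ = w →
        ((ω ++ [i]).map t).prod = ((ω' ++ [j]).map t).prod := by
      intro ω ω' i j u u' hij hu hui huw hu' huj hu'w
      have hu1 : u = w * Equiv.swap i.castSucc i.succ := by rw [← huw]; simp [mul_assoc]
      have hu2 : u' = w * Equiv.swap j.castSucc j.succ := by rw [← hu'w]; simp [mul_assoc]
      have hi : w i.succ < w i.castSucc := by simpa [hu1] using hui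
      have hj : w j.succ < w j.castSucc := by simpa [hu2] using huj
      have ih1 := @ih i hi
      have ih2 := @ih j hj
      rw [← hu1] at ih1
      rw [← hu2] at ih2
      rcases (Nat.succ_le_of_lt hij).eq_or_lt with h | h
      · have hs : j.castSucc = i.succ := Fin.ext (by simp; omega)
        have e1 : i.castSucc ≠ i.succ := (Fin.castSucc_lt_succ (i := i)).ne
        have e2 : i.castSucc ≠ j.succ := by simp [Fin.ext_iff]; omega
        have e3 : i.succ ≠ j.succ := by simp [Fin.ext_iff]; omega
        rw [hs] at hj hu2
        have hb := swap_braid e1 e2 e3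
        set a := Equiv.swap i.castSucc i.succ with ha
        set b := Equiv.swap i.succ j.succ with hb'
        have haa : a * a = 1 := Equiv.swap_mul_self _ _
        have hbb : b * b = 1 := Equiv.swap_mul_self _ _
        -- `w` is decreasing on the three positions involved; `a * b * a` reverses them, so the
        -- letters appended to `ν` below all create inversions.
        obtain ⟨ν, hν⟩ := exists_isAscendingWord (w * (a * b * a))
        have v1 : (w * (a * b * a)) i.castSucc = w j.succ := by
          simp [ha, hb', Equiv.swap_apply_of_ne_of_ne, e2.symm, e3.symm]
        have v2 : (w * (a * b * a)) i.succ = w i.succ := by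
          simp [ha, hb', Equiv.swap_apply_of_ne_of_ne, e1, e2]
        have v3 : (w * (a * b * a)) j.succ = w i.castSucc := by
          simp [ha, hb', Equiv.swap_apply_of_ne_of_ne, e2.symm, e3.symm]
        have p1 : IsAscendingWord (ν ++ [i]) (w * (a * b)) :=
          hν.snoc_eq (by rw [v1, v2]; exact hj) (by
            rw [← ha, mul_assoc w, mul_assoc (a * b), haa, mul_one])
        have p2 : IsAscendingWord (ν ++ [i] ++ [j]) u :=
          p1.snoc_eq (by
            rw [hs]
            simpa [ha, hb', Equiv.swap_apply_of_ne_of_ne, e1, e2, e3, e1.symm, e2.symm, e3.symm]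
              using hj.trans hi) (by
            rw [hs, ← hb', mul_assoc w, mul_assoc a, hbb, mul_one, hu1])
        have q1 : IsAscendingWord (ν ++ [j]) (w * (b * a)) :=
          hν.snoc_eq (by rw [hs, v2, v3]; exact hi) (by
            rw [hs, ← hb', hb, mul_assoc w, mul_assoc (b * a), hbb, mul_one])
        have q2 : IsAscendingWord (ν ++ [j] ++ [i]) u' :=
          q1.snoc_eq (by
            simpa [ha, hb', Equiv.swap_apply_of_ne_of_ne, e1, e2, e3, e1.symm, e2.symm, e3.symm]
              using hj.trans hi) (by
            rw [← ha, mul_assoc w, mul_assoc b, haa, mul_one, hu2])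
        have r1 := ih1 hu p2
        have r2 := ih2 hu' q2
        have hbr := ht.braid i j h
        simp only [List.map_append, List.prod_append, List.map_cons, List.map_nil,
          List.prod_cons, List.prod_nil, mul_one] at r1 r2 ⊢
        rw [r1, r2]
        simp only [mul_assoc] at hbr ⊢
        rw [hbr]
      · have e1 : i.castSucc ≠ j.castSucc := by simp [Fin.ext_iff]; omega
        have e2 : i.castSucc ≠ j.succ := by simp [Fin.ext_iff]; omega
        have e3 : i.succ ≠ j.castSucc := by simp [Fin.ext_iff]; omega
        have e4 : i.succ ≠ j.succ := by simp [Fin.ext_iff]; omega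
        have hc := swap_adj_far h
        set a := Equiv.swap i.castSucc i.succ with ha
        set b := Equiv.swap j.castSucc j.succ with hb'
        have haa : a * a = 1 := Equiv.swap_mul_self _ _
        have hbb : b * b = 1 := Equiv.swap_mul_self _ _
        obtain ⟨ν, hν⟩ := exists_isAscendingWord (w * (a * b))
        have p1 : IsAscendingWord (ν ++ [j]) u :=
          hν.snoc_eq (by
            simpa [ha, hb', Equiv.swap_apply_of_ne_of_ne, e1, e2, e3, e4, e1.symm, e2.symm,
              e3.symm, e4.symm] using hj) (by
            rw [← hb', mul_assoc w, mul_assoc a, hbb, mul_one, hu1])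
        have q1 : IsAscendingWord (ν ++ [i]) u' :=
          hν.snoc_eq (by
            simpa [ha, hb', Equiv.swap_apply_of_ne_of_ne, e1, e2, e3, e4, e1.symm, e2.symm,
              e3.symm, e4.symm] using hi) (by
            rw [← ha, hc, mul_assoc w, mul_assoc b, haa, mul_one, hu2])
        have r1 := ih1 hu p1
        have r2 := ih2 hu' q1
        have hbr := ht.comm i j h
        simp only [List.map_append, List.prod_append, List.map_cons, List.map_nil,
          List.prod_cons, List.prod_nil, mul_one] at r1 r2 ⊢
        rw [r1, r2, mul_assoc, mul_assoc, hbr]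
    have nodesc : ∀ {u : Equiv.Perm (Fin (m + 1))} {i : Fin m}, u i.castSucc < u i.succ →
        u * Equiv.swap i.castSucc i.succ ≠ 1 := by
      intro u i hi h
      have hu : u = Equiv.swap i.castSucc i.succ := by
        rw [mul_eq_one_iff_eq_inv] at h
        simpa using h
      rw [hu] at hi
      simp only [Equiv.swap_apply_left, Equiv.swap_apply_right] at hi
      exact absurd hi (Fin.castSucc_lt_succ (i := i)).asymm
    intro ω ω' hω hω'
    -- Separate names for `w` let each case split unify its own index.
    generalize hw : w = w₁ at hω
    generalize hw' : w = w₂ at hω'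
    cases hω with
    | nil =>
      cases hω' with
      | nil => rfl
      | snoc h hi => exact absurd (hw'.symm.trans hw) (nodesc hi)
    | snoc h hi =>
      cases hω' with
      | nil => exact absurd (hw.symm.trans hw') (nodesc hi)
      | @snoc ω₂ u₂ j h' hj =>
        rename_i ω₁ u₁ i
        rcases lt_trichotomy i.val j.val with hij | hij | hij
        · exact aux hij h hi hw.symm h' hj hw'.symm
        · obtain rfl : i = j := Fin.ext hij
          have hu1 : u₁ = w * Equiv.swap i.castSucc i.succ := by rw [hw]; simp [mul_assoc]
          have hu2 : u₂ = w * Equiv.swap i.castSucc i.succ := by rw [hw']; simp [mul_assoc]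
          rw [List.map_append, List.map_append, List.prod_append, List.prod_append,
            ih i (by simpa [hu1] using hi) (hu1 ▸ h) (hu2 ▸ h')]
        · exact (aux hij h' hj hw'.symm h hi hw.symm).symm

/-- A constant family is braided, and its product counts letters. -/
theorem IsAscendingWord.length_eq {w : Equiv.Perm (Fin (m + 1))} {ω ω' : List (Fin m)}
    (h : IsAscendingWord ω w) (h' : IsAscendingWord ω' w) : ω.length = ω'.length := by
  have ht : IsBraided fun _ : Fin m => Multiplicative.ofAdd 1 := ⟨fun _ _ _ => rfl, fun _ _ _ => rfl⟩
  have := h.prod_eq ht h'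
  simpa [List.map_const', ← ofAdd_nsmul] using this

/-- If the last letter removed an inversion, an ascending word of `w` followed by that letter would
be ascending for the prefix, making the prefix longer than a word of `w` and contradicting
minimality. -/
theorem IsReducedWord.isAscendingWord {w : Equiv.Perm (Fin (m + 1))} {ω : List (Fin m)}
    (h : IsReducedWord w ω) : IsAscendingWord ω w := by
  have happ : ∀ (ω : List (Fin m)) (i : Fin m), permOfWord (m + 1) (ω ++ [i]) =
      permOfWord (m + 1) ω * Equiv.swap i.castSucc i.succ := by
    intro ω i
    simp only [permOfWord, List.map_append, List.prod_append, List.map_cons, List.map_nil,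
      List.prod_cons, List.prod_nil, mul_one]
    rfl
  induction ω using List.reverseRecOn generalizing w with
  | nil => rw [← h.1]; exact .nil
  | append_singleton ω i ih =>
    obtain ⟨h1, h2⟩ := h
    replace h2 : ∀ ω' : List (Fin m), permOfWord (m + 1) ω' = w →
        (ω ++ [i]).length ≤ ω'.length := h2
    have hmin : ∀ ω' : List (Fin m), permOfWord (m + 1) ω' = permOfWord (m + 1) ω →
        ω.length ≤ ω'.length := by
      intro ω' h'
      have := h2 (ω' ++ [i]) (by rw [happ, ← h1, happ, h'])
      simpa using this
    have hred : IsReducedWord (permOfWord (m + 1) ω) ω := ⟨rfl, hmin⟩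
    have hasc := ih hred
    rw [happ] at h1
    by_cases hi : permOfWord (m + 1) ω i.castSucc < permOfWord (m + 1) ω i.succ
    · exact hasc.snoc_eq hi h1
    · exfalso
      have hi' : permOfWord (m + 1) ω i.succ < permOfWord (m + 1) ω i.castSucc :=
        lt_of_le_of_ne (not_lt.1 hi) fun h =>
          (Fin.castSucc_lt_succ (i := i)).ne' ((permOfWord (m + 1) ω).injective h)
      obtain ⟨ν, hν⟩ := exists_isAscendingWord w
      have hν' : IsAscendingWord (ν ++ [i]) (permOfWord (m + 1) ω) :=
        hν.snoc_eq (by simpa [← h1] using hi') (by rw [← h1]; simp [mul_assoc])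
      have hl := hasc.length_eq hν'
      have := h2 ν hν.permOfWord_eq
      simp at hl this
      omega

end Ascending

/-! ### The combinatorial model and its relations -/

section Action

/-- The states of the combinatorial model: an arrangement together with the exponent of the last
generator. -/
abbrev State : Type := (ℕ → WithTop ℕ) × ℕ

/-- The arrangement `v` with the entries at `i` and `i + 1` exchanged. -/
def swapAt (i : ℕ) (v : ℕ → WithTop ℕ) : ℕ → WithTop ℕ := v ∘ Equiv.swap i (i + 1)

@[simp] theorem swapAt_left (i : ℕ) (v : ℕ → WithTop ℕ) : swapAt i v i = v (i + 1) := by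
  simp [swapAt]

@[simp] theorem swapAt_right (i : ℕ) (v : ℕ → WithTop ℕ) : swapAt i v (i + 1) = v i := by
  simp [swapAt]

theorem swapAt_of_ne {i x : ℕ} (v : ℕ → WithTop ℕ) (h : x ≠ i) (h' : x ≠ i + 1) :
    swapAt i v x = v x := by
  rw [swapAt, Function.comp_apply, Equiv.swap_apply_of_ne_of_ne h h']

theorem swapAt_braid (v : ℕ → WithTop ℕ) (i : ℕ) :
    swapAt i (swapAt (i + 1) (swapAt i v)) = swapAt (i + 1) (swapAt i (swapAt (i + 1) v)) := by
  have h := swap_braid (x := i) (y := i + 1) (z := i + 1 + 1) (by omega) (by omega) (by omega)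
  funext x
  exact congrArg v (by simpa using Equiv.congr_fun h x)

theorem swapAt_comm (v : ℕ → WithTop ℕ) {i j : ℕ} (h : i + 1 < j) :
    swapAt i (swapAt j v) = swapAt j (swapAt i v) := by
  funext x
  simp only [swapAt, Function.comp_apply, Equiv.swap_apply_def]
  congr 1
  split_ifs <;> omega

/-- The partial right action of the letter `i` on states: letters below the last one sort
increasing neighbours decreasingly, the last one also counts its own powers. -/
noncomputable def act (n d i : ℕ) (x : State) : Option State :=
  if x.1 i < x.1 (i + 1) then
    if i + 1 < n then some (swapAt i x.1, x.2)
    else if x.1 (i + 1) = ⊤ ∨ x.2 = 1 then some (swapAt i x.1, 1) else none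
  else if i + 1 = n ∧ x.1 (i + 1) < x.1 i ∧ x.1 i = ⊤ ∧ 1 ≤ x.2 ∧ x.2 + 1 < d then some (x.1, x.2 + 1)
  else none

theorem act_of_lt {n d i : ℕ} (hi : i + 1 < n) (x : State) :
    act n d i x = if x.1 i < x.1 (i + 1) then some (swapAt i x.1, x.2) else none := by
  simp [act, hi, hi.ne]

theorem act_of_eq {n d i : ℕ} (hi : i + 1 = n) (x : State) :
    act n d i x = if x.1 i < x.1 (i + 1) then
      if x.1 (i + 1) = ⊤ ∨ x.2 = 1 then some (swapAt i x.1, 1) else none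
    else if x.1 (i + 1) < x.1 i ∧ x.1 i = ⊤ ∧ 1 ≤ x.2 ∧ x.2 + 1 < d then some (x.1, x.2 + 1)
    else none := by
  simp [act, hi]

/-- Only the relative order of three consecutive entries matters, plus, when the last letter occurs,
the exponent and which entries are `⊤`. -/
theorem act_braid (n d i : ℕ) (hi : i + 1 < n) (x : State) :
    ((act n d i x).bind (act n d (i + 1))).bind (act n d i) =
      ((act n d (i + 1) x).bind (act n d i)).bind (act n d (i + 1)) := by
  obtain ⟨v, e⟩ := x
  have hv := swapAt_braid v i
  have a3 : ∀ u : ℕ → WithTop ℕ, swapAt i u (i + 1 + 1) = u (i + 1 + 1) :=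
    fun u => swapAt_of_ne u (by omega) (by omega)
  have b1 : ∀ u : ℕ → WithTop ℕ, swapAt (i + 1) u i = u i :=
    fun u => swapAt_of_ne u (by omega) (by omega)
  by_cases h1 : v i < v (i + 1) <;> by_cases h2 : v (i + 1) < v (i + 1 + 1) <;>
    by_cases h3 : v i < v (i + 1 + 1)
  all_goals first | exact absurd (h1.trans h2) h3 | skip
  all_goals rcases Nat.lt_or_ge (i + 1 + 1) n with hn | hn
  all_goals first | (simp [act_of_lt hi, act_of_lt hn, a3, b1, h1, h2, h3, hv]) | skip
  -- What remains involves the last letter; the bounds by `⊤` below rule out entries above an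
  -- infinite one.
  all_goals replace hn : i + 1 + 1 = n := by omega
  all_goals
    have t1 : v i ≤ ⊤ := le_top
    have t2 : v (i + 1) ≤ ⊤ := le_top
    have t3 : v (i + 1 + 1) ≤ ⊤ := le_top
    simp only [act_of_lt hi, act_of_eq hn, a3, swapAt_right, h1, h2, h3,
        Option.bind_some, Option.bind_none, if_true, if_false]
    repeat' (split <;> try simp only [a3, b1, swapAt_left, swapAt_right, h1, h2, h3, hv,
        Option.bind_some, Option.bind_none, if_true, if_false])
  all_goals
    clear a3 b1 hv
    grind

theorem act_comm (n d i j : ℕ) (h : i + 1 < j) (hj : j < n) (x : State) :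
    (act n d i x).bind (act n d j) = (act n d j x).bind (act n d i) := by
  obtain ⟨v, e⟩ := x
  have a1 : ∀ u : ℕ → WithTop ℕ, swapAt i u j = u j :=
    fun u => swapAt_of_ne u (by omega) (by omega)
  have a2 : ∀ u : ℕ → WithTop ℕ, swapAt i u (j + 1) = u (j + 1) :=
    fun u => swapAt_of_ne u (by omega) (by omega)
  have b1 : ∀ u : ℕ → WithTop ℕ, swapAt j u i = u i :=
    fun u => swapAt_of_ne u (by omega) (by omega)
  have b2 : ∀ u : ℕ → WithTop ℕ, swapAt j u (i + 1) = u (i + 1) :=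
    fun u => swapAt_of_ne u (by omega) (by omega)
  have hv := swapAt_comm v h
  have hi : i + 1 < n := by omega
  by_cases h1 : v i < v (i + 1)
  · rw [act_of_lt hi, if_pos h1, Option.bind_some]
    simp only [act, a1, a2]
    split_ifs <;> simp [act_of_lt hi, b1, b2, h1, hv]
  · rw [act_of_lt hi, if_neg h1, Option.bind_none, act]
    split_ifs <;> simp [act_of_lt hi, b1, b2, h1]

theorem act_sq (n d i : ℕ) (hi : i + 1 < n) (x : State) :
    (act n d i x).bind (act n d i) = none := by
  rw [act_of_lt hi]
  split_ifs with h
  · simp [act_of_lt hi, h.le]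
  · rfl

theorem act_pow_none (n d i : ℕ) (hd : 2 ≤ d) (hi : i + 1 = n) (x : State) :
    (fun o : Option State => o.bind (act n d i))^[d] (some x) = none := by
  set f := fun o : Option State => o.bind (act n d i) with hf
  have hnone : ∀ r, f^[r] none = none := fun r => Function.iterate_fixed rfl r
  -- Once the neighbours are not increasing, each surviving step raises the exponent, which must
  -- stay below `d`.
  have htop : ∀ r (v : ℕ → WithTop ℕ) (e : ℕ), ¬ v i < v (i + 1) → 1 ≤ e → d ≤ e + r → 1 ≤ r →
      f^[r] (some (v, e)) = none := by
    intro r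
    induction r with
    | zero => intros; omega
    | succ r ih =>
      intro v e h1 h2 h3 h4
      rw [Function.iterate_succ_apply]
      have : f (some (v, e)) = act n d i (v, e) := rfl
      rw [this, act, if_neg h1]
      split_ifs with h
      · exact ih v (e + 1) h1 (by omega) (by omega) (by simp at h; omega)
      · exact hnone r
  obtain ⟨v, e⟩ := x
  by_cases h : v i < v (i + 1)
  · obtain ⟨r, rfl⟩ : ∃ r, d = r + 1 := ⟨d - 1, by omega⟩
    rw [Function.iterate_succ_apply]
    have : f (some (v, e)) = act n (r + 1) i (v, e) := rfl
    have hn : ¬ i + 1 < n := by omega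
    have hnl : ¬ swapAt i v i < swapAt i v (i + 1) := by
      simpa using h.le
    rw [this, act, if_pos h, if_neg hn]
    simp only
    split_ifs
    · exact htop r _ 1 hnl le_rfl (by omega) (by omega)
    · exact hnone r
  · rcases Nat.eq_zero_or_pos e with rfl | he
    · obtain ⟨r, rfl⟩ : ∃ r, d = r + 1 := ⟨d - 1, by omega⟩
      rw [Function.iterate_succ_apply]
      have : f (some (v, 0)) = act n (r + 1) i (v, 0) := rfl
      rw [this, act, if_neg h]
      split_ifs
      · exact htop r _ 1 h le_rfl (by omega) (by omega)
      · exact hnone r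
    · exact htop d v e h he (by omega) (by omega)

end Action

/-! ### Linearization of the action -/

section Representation

variable (k : Type*) [CommRing k]

/-- The basis vector of a state, and `0` for the undefined state. -/
noncomputable def optVec (o : Option State) : State →₀ k :=
  o.elim 0 fun x => Finsupp.single x 1

/-- The linear extension of the partial action of a letter. -/
noncomputable def actLin (n d i : ℕ) : Module.End k (State →₀ k) :=
  Finsupp.linearCombination k fun x => optVec k (act n d i x)

theorem actLin_optVec (n d i : ℕ) (o : Option State) :
    actLin k n d i (optVec k o) = optVec k (o.bind (act n d i)) := by
  cases o <;> simp [optVec, actLin]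

theorem end_ext_optVec {f g : Module.End k (State →₀ k)}
    (h : ∀ x, f (optVec k (some x)) = g (optVec k (some x))) : f = g :=
  Finsupp.lhom_ext' fun x => LinearMap.ext_ring (h x)

/-- Words act from the right, so their first letter applies first; the opposite of the endomorphism
algebra accounts for this. -/
theorem isBraided_actLin (n d : ℕ) :
    IsBraided fun i : Fin n => MulOpposite.op (actLin k n d i) := by
  refine ⟨fun i j h => ?_, fun i j h => ?_⟩
  · simp only [← MulOpposite.op_mul]
    congr 1
    apply end_ext_optVec
    intro x
    have := act_braid n d i (by omega) x
    simp only [Module.End.mul_apply, actLin_optVec, ← h, Option.bind_some]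
    rw [this]
  · simp only [← MulOpposite.op_mul]
    congr 1
    apply end_ext_optVec
    intro x
    have := act_comm n d i j h j.isLt x
    simp only [Module.End.mul_apply, actLin_optVec, Option.bind_some]
    rw [this]

theorem actLin_pow {n d : ℕ} (hd : 2 ≤ d) (i : Fin n) :
    MulOpposite.op (actLin k n d i) ^ dVec n d i = 0 := by
  rw [← MulOpposite.op_pow, ← MulOpposite.op_zero]
  congr 1
  apply end_ext_optVec
  intro x
  have key : ∀ r o, (actLin k n d i ^ r) (optVec k o) =
      optVec k ((fun o : Option State => o.bind (act n d i))^[r] o) := by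
    intro r
    induction r with
    | zero => intro o; rfl
    | succ r ih =>
      intro o
      rw [pow_succ, Module.End.mul_apply, actLin_optVec, ih, Function.iterate_succ_apply]
  rw [key, dVec]
  split_ifs with h
  · rw [act_pow_none n d i hd h]; rfl
  · change optVec k (((some x).bind (act n d i)).bind (act n d i)) = 0
    rw [Option.bind_some, act_sq n d i (by omega)]; rfl

/-- The right regular action of `NC_A(n,d)` on the linear span of the states. -/
noncomputable def stateRep {n d : ℕ} (hd : 2 ≤ d) :
    NCA k n d →ₐ[k] (Module.End k (State →₀ k))ᵐᵒᵖ :=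
  liftA k _ (isBraided_actLin k n d) (actLin_pow k hd)

/-- The arrangement `0, 1, …, n - 1, ∞, ∞, …`. -/
noncomputable def startVec (n : ℕ) (i : ℕ) : WithTop ℕ := if i < n then (i : WithTop ℕ) else ⊤

/-- The vector of states obtained by acting on the initial state. -/
noncomputable def coord {n d : ℕ} (hd : 2 ≤ d) : NCA k n d →ₗ[k] (State →₀ k) where
  toFun x := (stateRep k hd x).unop (optVec k (some (startVec n, 0)))
  map_add' x y := by simp
  map_smul' c x := by simp

theorem coord_one {n d : ℕ} (hd : 2 ≤ d) :
    coord k hd (1 : NCA k n d) = optVec k (some (startVec n, 0)) := by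
  simp [coord]

theorem coord_mul_TA {n d : ℕ} (hd : 2 ≤ d) {x : NCA k n d} {o : Option State}
    (h : coord k hd x = optVec k o) (i : Fin n) :
    coord k hd (x * TA k n d i) = optVec k (o.bind (act n d i)) := by
  rw [← actLin_optVec, ← h]
  simp [coord, stateRep, liftA_T]

end Representation

/-! ### Arrangements reached by standard words -/

section Arrangements

/-- The arrangement `w 0, …, w m, m + 1, …, n - 1, ∞, ∞, …`. -/
noncomputable def permVec (n : ℕ) {m : ℕ} (w : Equiv.Perm (Fin m)) (i : ℕ) : WithTop ℕ :=
  if h : i < m then ((w ⟨i, h⟩ : ℕ) : WithTop ℕ) else startVec n i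

theorem permVec_one (n m : ℕ) (h : m ≤ n) : permVec n (1 : Equiv.Perm (Fin m)) = startVec n := by
  funext i
  rw [permVec]
  split_ifs with hi
  · simp [startVec, hi.trans_le h]
  · rfl

theorem permVec_injective (n m : ℕ) : Function.Injective (permVec n (m := m)) := by
  intro w w' h
  ext i
  have := congrFun h i
  simpa [permVec] using this

theorem permVec_lt_top {n m : ℕ} (w : Equiv.Perm (Fin m)) {i : ℕ} (hi : i < n) :
    permVec n w i < ⊤ := by
  rw [permVec]
  split_ifs
  · exact WithTop.coe_lt_top _
  · rw [startVec, if_pos hi]; exact WithTop.coe_lt_top _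

theorem permVec_eq_top {n m : ℕ} (h : m ≤ n) (w : Equiv.Perm (Fin m)) {i : ℕ} (hi : n ≤ i) :
    permVec n w i = ⊤ := by
  rw [permVec, dif_neg (by omega), startVec, if_neg (by omega)]

theorem swapAt_permVec (n : ℕ) {m : ℕ} (w : Equiv.Perm (Fin (m + 1))) (i : Fin m) :
    swapAt i (permVec n w) = permVec n (w * Equiv.swap i.castSucc i.succ) := by
  funext x
  by_cases hx : x < m + 1
  · have : (permVec n w) (Equiv.swap (i : ℕ) (i + 1) x) =
        ((w (Equiv.swap i.castSucc i.succ ⟨x, hx⟩) : ℕ) : WithTop ℕ) := by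
      have h2 : Equiv.swap (i : ℕ) (i + 1) x = (Equiv.swap i.castSucc i.succ ⟨x, hx⟩ : ℕ) := by
        simp only [Equiv.swap_apply_def, Fin.ext_iff, Fin.val_castSucc, Fin.val_succ]
        split_ifs <;> simp
      rw [h2, permVec, dif_pos (Fin.isLt _)]
    rw [swapAt, Function.comp_apply, this, permVec, dif_pos hx]
    rfl
  · rw [swapAt_of_ne _ (by omega) (by omega), permVec, permVec, dif_neg hx, dif_neg hx]

theorem act_permVec {n d m : ℕ} (h : m < n) (w : Equiv.Perm (Fin (m + 1))) (i : Fin m)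
    (hi : w i.castSucc < w i.succ) (e : ℕ) :
    act n d i (permVec n w, e) = some (permVec n (w * Equiv.swap i.castSucc i.succ), e) := by
  have h1 : permVec n w i < permVec n w (i + 1) := by
    rw [permVec, permVec, dif_pos (by omega), dif_pos (by omega)]
    exact_mod_cast hi
  rw [act_of_lt (by omega), if_pos h1, swapAt_permVec]

theorem IsAscendingWord.coord_prod (k : Type*) [CommRing k] {n d m : ℕ} (hd : 2 ≤ d) (h : m < n)
    {ω : List (Fin m)} {w : Equiv.Perm (Fin (m + 1))} (hω : IsAscendingWord ω w) :
    coord k hd (ω.map fun i => TA k n d (i.castLE h.le)).prod =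
      optVec k (some (permVec n w, 0)) := by
  induction hω with
  | nil => rw [permVec_one n _ h]; exact coord_one k hd
  | @snoc ω w i hω hi ih =>
    have := coord_mul_TA k hd ih (i.castLE h.le)
    rw [Option.bind_some, Fin.val_castLE, act_permVec h w i hi] at this
    simpa using this

/-- The arrangement `v` with an entry `∞` inserted at position `b`. -/
noncomputable def insertTop (b : ℕ) (v : ℕ → WithTop ℕ) (i : ℕ) : WithTop ℕ :=
  if i < b then v i else if i = b then ⊤ else v (i - 1)

/-- The infinite tail absorbs one more `⊤`; hence the arrangement of `w` already counts as having a
`⊤` inserted at `n`, ready to be moved left. -/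
theorem insertTop_of_eq_top {b : ℕ} {v : ℕ → WithTop ℕ} (h : ∀ i, b ≤ i → v i = ⊤) :
    insertTop b v = v := by
  funext i
  rw [insertTop]
  split_ifs with h1 h2
  · rfl
  · rw [h i h2.ge]
  · rw [h i (by omega), h (i - 1) (by omega)]

theorem swapAt_insertTop (b : ℕ) (v : ℕ → WithTop ℕ) :
    swapAt b (insertTop (b + 1) v) = insertTop b v := by
  funext i
  rcases eq_or_ne i b with rfl | h1
  · simp [insertTop]
  rcases eq_or_ne i (b + 1) with rfl | h2
  · simp [insertTop]
  rw [swapAt_of_ne _ h1 h2, insertTop, insertTop]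
  split_ifs <;> first | rfl | omega

theorem act_insertTop {n d b : ℕ} {v : ℕ → WithTop ℕ} (hb : b + 1 < n) (hv : v b < ⊤) (e : ℕ) :
    act n d b (insertTop (b + 1) v, e) = some (insertTop b v, e) := by
  rw [act_of_lt hb, if_pos (by simpa [insertTop] using hv), swapAt_insertTop]

theorem act_insertTop_last {n d b : ℕ} {v : ℕ → WithTop ℕ} (hb : b + 1 = n) (hv : v b < ⊤)
    (e : ℕ) : act n d b (insertTop (b + 1) v, e) = some (insertTop b v, 1) := by
  rw [act_of_eq hb, if_pos (by simpa [insertTop] using hv), if_pos (by simp [insertTop]),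
    swapAt_insertTop]

theorem act_insertTop_pow {n d b : ℕ} {v : ℕ → WithTop ℕ} (hb : b + 1 = n) (hv : v b < ⊤)
    {e : ℕ} (he : 1 ≤ e) (hed : e + 1 < d) :
    act n d b (insertTop b v, e) = some (insertTop b v, e + 1) := by
  have h1 : insertTop b v b = ⊤ := by simp [insertTop]
  have h2 : insertTop b v (b + 1) = v b := by simp [insertTop]
  rw [act_of_eq hb]
  simp [h1, h2, hv, he, hed]

/-- The insertion point is recovered as the position of the first `⊤`. -/
theorem insertTop_injOn {n b b' : ℕ} {v v' : ℕ → WithTop ℕ} (hb : b ≤ n) (hb' : b' ≤ n)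
    (hv : ∀ i < n, v i < ⊤) (hv' : ∀ i < n, v' i < ⊤) (h : insertTop b v = insertTop b' v') :
    b = b' ∧ ∀ i < n, v i = v' i := by
  have key : ∀ {b b' : ℕ} {v v' : ℕ → WithTop ℕ}, b' ≤ n → (∀ i < n, v' i < ⊤) →
      insertTop b v = insertTop b' v' → ¬ b < b' := by
    intro b b' v v' hb' hv' h hlt
    have h1 := congrFun h b
    simp only [insertTop, lt_irrefl, if_false, if_true, hlt] at h1
    exact (hv' b (hlt.trans_le hb')).ne h1.symm
  have hbb : b = b' := by
    rcases lt_trichotomy b b' with h1 | h1 | h1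
    · exact absurd h1 (key hb' hv' h)
    · exact h1
    · exact absurd h1 (key hb hv h.symm)
  subst hbb
  refine ⟨rfl, fun i hi => ?_⟩
  by_cases hib : i < b
  · simpa [insertTop, hib] using congrFun h i
  · have := congrFun h (i + 1)
    simpa [insertTop, show ¬ i + 1 < b by omega, show i + 1 ≠ b by omega] using this

end Arrangements

/-! ### Spanning by products along permutations -/

section Spanning

variable (k : Type*) [CommRing k]

theorem adjoin_le_of_mul_mem {A : Type*} [Semiring A] [Algebra k A] {s : Set A}
    {S : Submodule k A} (h1 : 1 ∈ S) (hS : ∀ x ∈ S, ∀ t ∈ s, x * t ∈ S) :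
    Subalgebra.toSubmodule (Algebra.adjoin k s) ≤ S := by
  intro y hy
  -- Quantifying over `x` is what lets the induction pass through products.
  have key : ∀ x ∈ S, x * y ∈ S := by
    induction hy using Algebra.adjoin_induction with
    | mem t ht => exact fun x hx => hS x hx t ht
    | algebraMap r =>
      intro x hx
      rw [← Algebra.commutes, ← Algebra.smul_def]
      exact S.smul_mem r hx
    | add a b _ _ ha hb =>
      intro x hx
      rw [mul_add]
      exact S.add_mem (ha x hx) (hb x hx)
    | mul a b _ _ ha hb =>
      intro x hx
      rw [← mul_assoc]
      exact hb _ (ha x hx)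
  simpa using key 1 h1

/-- The product of the values of `t` along an ascending word of `w`. -/
noncomputable def permProd {A : Type*} [Monoid A] {m : ℕ} (t : Fin m → A)
    (w : Equiv.Perm (Fin (m + 1))) : A :=
  ((exists_isAscendingWord w).choose.map t).prod

theorem IsAscendingWord.prod_eq_permProd {A : Type*} [Monoid A] {m : ℕ} {t : Fin m → A}
    (ht : IsBraided t) {ω : List (Fin m)} {w : Equiv.Perm (Fin (m + 1))}
    (h : IsAscendingWord ω w) : (ω.map t).prod = permProd t w :=
  h.prod_eq ht (exists_isAscendingWord w).choose_spec

theorem permProd_one {A : Type*} [Monoid A] {m : ℕ} {t : Fin m → A} (ht : IsBraided t) :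
    permProd t 1 = 1 := by
  rw [← IsAscendingWord.nil.prod_eq_permProd ht, List.map_nil, List.prod_nil]

theorem permProd_mul {A : Type*} [Monoid A] {m : ℕ} {t : Fin m → A} (ht : IsBraided t)
    {w : Equiv.Perm (Fin (m + 1))} {i : Fin m} (h : w i.castSucc < w i.succ) :
    permProd t w * t i = permProd t (w * Equiv.swap i.castSucc i.succ) := by
  rw [← ((exists_isAscendingWord w).choose_spec.snoc h).prod_eq_permProd ht]
  simp [permProd]

theorem adjoin_range_le_span_permProd {A : Type*} [Semiring A] [Algebra k A] {m : ℕ}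
    {t : Fin m → A} (ht : IsBraided t) (hsq : ∀ i, t i * t i = 0) :
    Subalgebra.toSubmodule (Algebra.adjoin k (Set.range t)) ≤
      Submodule.span k (Set.range (permProd t)) := by
  apply adjoin_le_of_mul_mem
  · exact Submodule.subset_span ⟨1, permProd_one ht⟩
  · rintro x hx _ ⟨i, rfl⟩
    induction hx using Submodule.span_induction with
    | zero => simp
    | add a b _ _ ha hb => rw [add_mul]; exact Submodule.add_mem _ ha hb
    | smul r a _ ha => rw [smul_mul_assoc]; exact Submodule.smul_mem _ r ha
    | mem x hx =>
      obtain ⟨w, rfl⟩ := hx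
      rcases lt_or_ge (w i.castSucc) (w i.succ) with h | h
      · rw [permProd_mul ht h]
        exact Submodule.subset_span ⟨_, rfl⟩
      · have h' : w i.succ < w i.castSucc := lt_of_le_of_ne h
          fun h => (Fin.castSucc_lt_succ (i := i)).ne' (w.injective h)
        have := permProd_mul ht (w := w * Equiv.swap i.castSucc i.succ) (i := i) (by simpa using h')
        rw [mul_assoc, Equiv.swap_mul_self, mul_one] at this
        rw [← this, mul_assoc, hsq, mul_zero]
        exact Submodule.zero_mem _

end Spanning

/-! ### Rewriting rules and spanning by standard words -/

section StandardWords

variable (k : Type*) [CommRing k]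

theorem descA_last {n d : ℕ} {b : Fin n} (h : b.val + 1 = n) : descA k n d b = 1 := by
  have : (List.finRange n).filter (fun j => b ≤ j ∧ j.val + 1 < n) = [] := by
    simp only [List.filter_eq_nil_iff, decide_eq_true_eq, Fin.le_def]
    intro a _
    omega
  rw [descA, this]
  simp

theorem descA_succ {n d : ℕ} {b c : Fin n} (h : b.val + 1 = c.val) :
    descA k n d b = descA k n d c * TA k n d b := by
  have : (List.finRange n).filter (fun j => b ≤ j ∧ j.val + 1 < n) =
      b :: (List.finRange n).filter (fun j => c ≤ j ∧ j.val + 1 < n) := by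
    -- Strictly increasing lists with the same members coincide.
    apply List.Pairwise.eq_of_mem_iff (r := (· < ·))
    · exact (List.pairwise_lt_finRange n).filter _
    · refine List.Pairwise.cons ?_ ((List.pairwise_lt_finRange n).filter _)
      intro a ha
      simp only [List.mem_filter, decide_eq_true_eq, Fin.le_def] at ha
      rw [Fin.lt_def]
      omega
    · intro a
      simp only [List.mem_filter, decide_eq_true_eq, List.mem_cons, List.mem_finRange, true_and,
        Fin.le_def, Fin.ext_iff]
      omega
  rw [descA, this, descA, List.reverse_cons, List.map_append, List.prod_append]
  simp

theorem fin_descending_induction {n : ℕ} {P : Fin n → Prop}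
    (hlast : ∀ b : Fin n, b.val + 1 = n → P b)
    (hstep : ∀ b c : Fin n, b.val + 1 = c.val → P c → P b) (b : Fin n) : P b := by
  induction hr : n - b.val using Nat.strong_induction_on generalizing b with
  | _ r ih =>
    by_cases h : b.val + 1 = n
    · exact hlast b h
    · exact hstep b ⟨b.val + 1, by omega⟩ rfl (ih _ (by simp only; omega) _ rfl)

variable {n d : ℕ}

theorem TA_braid {i j : Fin n} (h : i.val + 1 = j.val) :
    TA k n d i * TA k n d j * TA k n d i = TA k n d j * TA k n d i * TA k n d j :=
  (isBraided_T k n (dVec n d)).braid i j h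

theorem TA_comm {i j : Fin n} (h : i.val + 1 < j.val) :
    TA k n d i * TA k n d j = TA k n d j * TA k n d i :=
  (isBraided_T k n (dVec n d)).comm i j h

theorem TA_mul_self {i : Fin n} (h : i.val + 1 < n) : TA k n d i * TA k n d i = 0 := by
  rw [← sq, TA_sq k i h]

theorem descA_mul_TA_of_lt {i : Fin n} (b : Fin n) (h : i.val + 1 < b.val) :
    descA k n d b * TA k n d i = TA k n d i * descA k n d b := by
  induction b using fin_descending_induction with
  | hlast b hb => rw [descA_last k hb, one_mul, mul_one]
  | hstep b c hbc ih =>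
    rw [descA_succ k hbc, mul_assoc, ← TA_comm k h, ← mul_assoc, ih (by omega), mul_assoc]

theorem descA_mul_TA_self {b : Fin n} (h : b.val + 1 < n) :
    descA k n d b * TA k n d b = 0 := by
  rw [descA_succ k (c := ⟨b.val + 1, h⟩) rfl, mul_assoc, TA_mul_self k h, mul_zero]

/-- The new letter moves left until it meets `T_j T_i` in the run; there `T_j T_i T_j = T_i T_j
T_i`, and the freed `T_i` commutes with all higher letters. -/
theorem descA_mul_TA_of_gt {i j : Fin n} (hij : i.val + 1 = j.val) (hj : j.val + 1 < n)
    (b : Fin n) (h : b.val ≤ i.val) :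
    descA k n d b * TA k n d j = TA k n d i * descA k n d b := by
  induction b using fin_descending_induction with
  | hlast b hb => omega
  | hstep b c hbc ih =>
    rcases h.eq_or_lt with h | h
    · obtain rfl : b = i := Fin.ext h
      obtain rfl : c = j := Fin.ext (by omega)
      rw [descA_succ k hbc, descA_succ k (c := ⟨c.val + 1, hj⟩) rfl]
      rw [mul_assoc, mul_assoc, ← mul_assoc (TA k n d c), ← TA_braid k hbc, mul_assoc (TA k n d b),
        ← mul_assoc, descA_mul_TA_of_lt k (i := b) ⟨c.val + 1, hj⟩ (by simp only; omega)]
      simp only [mul_assoc]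
    · rw [descA_succ k hbc, mul_assoc, TA_comm k (i := b) (j := j) (by omega), ← mul_assoc,
        ih (by omega), mul_assoc]

theorem TA_mul_descA_of_penultimate {p : Fin n} (hp : p.val + 2 = n) (b : Fin n)
    (h : b.val ≤ p.val) : TA k n d p * descA k n d b = 0 := by
  induction b using fin_descending_induction with
  | hlast b hb => omega
  | hstep b c hbc ih =>
    rcases h.eq_or_lt with h | h
    · obtain rfl : b = p := Fin.ext h
      rw [descA_succ k hbc, descA_last k (by omega), one_mul, TA_mul_self k (by omega)]
    · rw [descA_succ k hbc, ← mul_assoc, ih (by omega), zero_mul]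

theorem TA_mul_descA_mul_TA_last {p q : Fin n} (hp : p.val + 2 = n) (hq : q.val + 1 = n)
    (b : Fin n) (h : b.val ≤ p.val) :
    TA k n d q * descA k n d b * TA k n d q = TA k n d p * TA k n d q * descA k n d b := by
  induction b using fin_descending_induction with
  | hlast b hb => omega
  | hstep b c hbc ih =>
    rcases h.eq_or_lt with h | h
    · obtain rfl : b = p := Fin.ext h
      rw [descA_succ k hbc, descA_last k (by omega), one_mul,
        TA_braid k (i := b) (j := q) (by omega)]
    · rw [descA_succ k hbc, mul_assoc, mul_assoc, TA_comm k (i := b) (j := q) (by omega),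
        ← mul_assoc, ← mul_assoc, ih (by omega), mul_assoc]

/-- Passing the last `T_n` through the run produces `T_n T_{n-1} T_n = T_{n-1} T_n T_{n-1}` directly
before the run, which itself starts with `T_{n-1}`; the square vanishes. -/
theorem TA_pow_mul_descA_mul_TA_last {p q : Fin n} (hp : p.val + 2 = n) (hq : q.val + 1 = n)
    (b : Fin n) (h : b.val ≤ p.val) (a : ℕ) :
    TA k n d q ^ (a + 2) * descA k n d b * TA k n d q = 0 := by
  rw [pow_succ, mul_assoc, mul_assoc, ← mul_assoc (TA k n d q),
    TA_mul_descA_mul_TA_last k hp hq b h, pow_succ]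
  have := TA_braid k (n := n) (d := d) (i := p) (j := q) (by omega)
  rw [mul_assoc, ← mul_assoc (TA k n d q), ← mul_assoc (TA k n d q), ← this,
    mul_assoc, TA_mul_descA_of_penultimate k hp b h, mul_zero, mul_zero]

theorem isBraided_TA_castSucc (m d : ℕ) :
    IsBraided fun i : Fin m => TA k (m + 1) d i.castSucc :=
  ⟨fun _ _ h => TA_braid k h, fun _ _ h => TA_comm k h⟩

theorem wordA_eq_TW {m d : ℕ} {w : Equiv.Perm (Fin (m + 1))} {ω : List (Fin m)}
    (h : IsReducedWord w ω) : wordA k (m + 1) d ω = TW k (m + 1) d w :=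
  h.isAscendingWord.prod_eq (isBraided_TA_castSucc k m d)
    (IsReducedWord.isAscendingWord (exists_isReducedWord w).choose_spec)

theorem TW_eq_permProd (m d : ℕ) (w : Equiv.Perm (Fin (m + 1))) :
    TW k (m + 1) d w = permProd (fun i : Fin m => TA k (m + 1) d i.castSucc) w :=
  (IsReducedWord.isAscendingWord (exists_isReducedWord w).choose_spec).prod_eq_permProd
    (isBraided_TA_castSucc k m d)

theorem span_stdWord (m d : ℕ) (hd : 2 ≤ d) :
    Submodule.span k (Set.range (stdWord k (m + 1) d (Nat.le_add_left 1 m))) = ⊤ := by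
  set S := Submodule.span k (Set.range (stdWord k (m + 1) d (Nat.le_add_left 1 m))) with hS
  set t : Fin m → NCA k (m + 1) d := fun i => TA k (m + 1) d i.castSucc with ht
  set A₀ := Algebra.adjoin k (Set.range t) with hA₀
  set q : Fin (m + 1) := Fin.last m with hq
  have hq' : q.val = m := rfl
  set L := TA k (m + 1) d q with hL
  have htb := isBraided_TA_castSucc k m d
  have htA : ∀ i : Fin (m + 1), i.val < m → TA k (m + 1) d i ∈ A₀ := fun i hi =>
    Algebra.subset_adjoin ⟨⟨i, hi⟩, rfl⟩
  have hspan : ∀ y ∈ A₀, y ∈ Submodule.span k (Set.range (TW k (m + 1) d)) := by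
    intro y hy
    have := adjoin_range_le_span_permProd k htb (fun i => TA_mul_self k (by simp)) hy
    rwa [← funext (TW_eq_permProd k m d)] at this
  have hTW : ∀ w, TW k (m + 1) d w ∈ A₀ := by
    intro w
    rw [TW_eq_permProd]
    apply list_prod_mem
    intro y hy
    obtain ⟨i, _, rfl⟩ := List.mem_map.1 hy
    exact Algebra.subset_adjoin ⟨i, rfl⟩
  -- Letters slid to the left need only land in `A₀`; they need not be recombined into a single
  -- `T_w`.
  have hmem : ∀ z : NCA k (m + 1) d, (∀ w, TW k (m + 1) d w * z ∈ S) → ∀ y ∈ A₀, y * z ∈ S := by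
    intro z hz y hy
    have := hspan y hy
    clear hy
    induction this using Submodule.span_induction with
    | zero => simp
    | add a b _ _ ha hb => rw [add_mul]; exact S.add_mem ha hb
    | smul r a _ ha => rw [smul_mul_assoc]; exact S.smul_mem r ha
    | mem x hx => obtain ⟨w, rfl⟩ := hx; exact hz w
  have hS0 : ∀ y ∈ A₀, y ∈ S := by
    intro y hy
    have := hmem 1 (fun w => by
      rw [mul_one]; exact Submodule.subset_span ⟨Sum.inl w, rfl⟩) y hy
    rwa [mul_one] at this
  have hS1 : ∀ y ∈ A₀, ∀ a, a + 1 < d → ∀ b, y * (L ^ (a + 1) * descA k (m + 1) d b) ∈ S := by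
    intro y hy a ha b
    refine hmem _ (fun w => ?_) y hy
    refine Submodule.subset_span ⟨Sum.inr (w, ⟨a, by omega⟩, b), ?_⟩
    rw [← mul_assoc]
    rfl
  have hcomm : ∀ i : Fin (m + 1), i.val + 1 < m → ∀ r, L ^ r * TA k (m + 1) d i =
      TA k (m + 1) d i * L ^ r := fun i hi r =>
    ((show Commute (TA k (m + 1) d i) L from TA_comm k hi).pow_right r).symm
  rw [eq_top_iff, ← Algebra.top_toSubmodule, ← adjoin_range_T k]
  refine adjoin_le_of_mul_mem k (hS0 1 A₀.one_mem) ?_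
  rintro x hx _ ⟨i, rfl⟩
  change x * TA k (m + 1) d i ∈ S
  induction hx using Submodule.span_induction with
  | zero => simp
  | add a b _ _ ha hb => rw [add_mul]; exact S.add_mem ha hb
  | smul r a _ ha => rw [smul_mul_assoc]; exact S.smul_mem r ha
  | mem x hx =>
    obtain ⟨w | ⟨w, a, b⟩, rfl⟩ := hx
    · change TW k (m + 1) d w * TA k (m + 1) d i ∈ S
      rcases (Nat.lt_succ_iff.1 i.isLt).lt_or_eq with hi | hi
      · exact hS0 _ (A₀.mul_mem (hTW w) (htA i hi))
      · obtain rfl : i = q := Fin.ext hi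
        have := hS1 _ (hTW w) 0 (by omega) q
        rwa [descA_last k (by omega), zero_add, pow_one, mul_one] at this
    · have ha : a.val + 1 < d := by omega
      change TW k (m + 1) d w * L ^ (a.val + 1) * descA k (m + 1) d b * TA k (m + 1) d i ∈ S
      rcases (Nat.lt_succ_iff.1 i.isLt).lt_or_eq with hi | hi
      · rcases lt_trichotomy i.val b.val with hib | hib | hib
        · rcases (Nat.succ_le_of_lt hib).eq_or_lt with h | h
          · rw [mul_assoc, ← descA_succ k h, mul_assoc]
            exact hS1 _ (hTW w) _ ha i
          · rw [mul_assoc, descA_mul_TA_of_lt k b h, ← mul_assoc, mul_assoc (TW k (m + 1) d w),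
              hcomm i (by omega), ← mul_assoc, mul_assoc]
            exact hS1 _ (A₀.mul_mem (hTW w) (htA i hi)) _ ha b
        · obtain rfl : i = b := Fin.ext hib
          rw [mul_assoc, descA_mul_TA_self k (by omega), mul_zero]
          exact S.zero_mem
        · rw [mul_assoc, descA_mul_TA_of_gt k (i := ⟨i.val - 1, by omega⟩) (by simp only; omega)
            (by omega) b (by simp only; omega), ← mul_assoc, mul_assoc (TW k (m + 1) d w),
            hcomm _ (by simp only; omega), ← mul_assoc, mul_assoc]
          exact hS1 _ (A₀.mul_mem (hTW w) (htA _ (by simp only; omega))) _ ha b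
      · obtain rfl : i = q := Fin.ext hi
        rcases (Nat.lt_succ_iff.1 b.isLt).lt_or_eq with hb | hb
        · have hp : (⟨m - 1, by omega⟩ : Fin (m + 1)).val + 2 = m + 1 := by simp only; omega
          rcases Nat.eq_zero_or_pos a.val with h0 | h0
          · rw [h0, zero_add, pow_one, mul_assoc, mul_assoc, ← mul_assoc L,
              TA_mul_descA_mul_TA_last k hp rfl b (by simp only; omega), mul_assoc, ← mul_assoc]
            have := hS1 _ (A₀.mul_mem (hTW w) (htA ⟨m - 1, by omega⟩ (by simp only; omega)))
              0 (by omega) b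
            rwa [zero_add, pow_one] at this
          · obtain ⟨r, hr⟩ : ∃ r, a.val = r + 1 := ⟨a.val - 1, by omega⟩
            rw [hr, mul_assoc, mul_assoc, ← mul_assoc (L ^ _),
              TA_pow_mul_descA_mul_TA_last k hp rfl b (by simp only; omega), mul_zero]
            exact S.zero_mem
        · obtain rfl : b = q := Fin.ext hb
          rw [descA_last k (by omega), mul_one, mul_assoc, ← pow_succ]
          rcases Nat.lt_or_ge (a.val + 1 + 1) d with h | h
          · have := hS1 _ (hTW w) (a.val + 1) h q
            rwa [descA_last k (by omega), mul_one] at this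
          · have hda : a.val + 1 + 1 = d := by omega
            rw [hda, hL, TA_pow k q rfl, mul_zero]
            exact S.zero_mem

end StandardWords

/-! ### Linear independence, the basis and the subalgebras `R_l` -/

section Independence

variable (k : Type*) [CommRing k]

theorem TW_coord {m d : ℕ} (hd : 2 ≤ d) (w : Equiv.Perm (Fin (m + 1))) :
    coord k hd (TW k (m + 1) d w) = optVec k (some (permVec (m + 1) w, 0)) :=
  (IsReducedWord.isAscendingWord (exists_isReducedWord w).choose_spec).coord_prod k hd
    (Nat.lt_succ_self m)

/-- The state reached from the initial one by a standard word. -/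
noncomputable def stdState (n d : ℕ) : StdIndex n d → State
  | Sum.inl w => (permVec n w, 0)
  | Sum.inr (w, a, b) => (insertTop b (permVec n w), a + 1)

theorem stdState_injective (n d : ℕ) : Function.Injective (stdState n d) := by
  rintro (w | ⟨w, a, b⟩) (w' | ⟨w', a', b'⟩) h
  · rw [permVec_injective n n (Prod.ext_iff.1 h).1]
  · exact absurd (Prod.ext_iff.1 h).2 (Nat.succ_ne_zero _).symm
  · exact absurd (Prod.ext_iff.1 h).2 (Nat.succ_ne_zero _)
  · obtain ⟨h1, h2⟩ := Prod.ext_iff.1 h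
    obtain ⟨hb, hw⟩ := insertTop_injOn b.isLt.le b'.isLt.le (fun i hi => permVec_lt_top w hi)
      (fun i hi => permVec_lt_top w' hi) h1
    have hww : w = w' := by
      apply permVec_injective n n
      funext i
      rcases Nat.lt_or_ge i n with hi | hi
      · exact hw i hi
      · rw [permVec_eq_top le_rfl w hi, permVec_eq_top le_rfl w' hi]
    have haa : a = a' := Fin.ext (Nat.succ.inj h2)
    rw [hww, haa, Fin.ext hb]

theorem coord_stdWord {m d : ℕ} (hd : 2 ≤ d) (x : StdIndex (m + 1) d) :
    coord k hd (stdWord k (m + 1) d (Nat.le_add_left 1 m) x) =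
      optVec k (some (stdState (m + 1) d x)) := by
  rcases x with w | ⟨w, a, b⟩
  · exact TW_coord k hd w
  · have hv : ∀ i < m + 1, permVec (m + 1) w i < ⊤ := fun i hi => permVec_lt_top w hi
    have hpow : ∀ r, r + 1 < d → coord k hd
        (TW k (m + 1) d w * TA k (m + 1) d (Fin.last m) ^ (r + 1)) =
          optVec k (some (insertTop m (permVec (m + 1) w), r + 1)) := by
      intro r
      induction r with
      | zero =>
        intro _
        rw [zero_add, pow_one, coord_mul_TA k hd (TW_coord k hd w), Option.bind_some]
        -- The tail supplies the `⊤` that the first `T_n` moves to position `m`.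
        conv_lhs => rw [← insertTop_of_eq_top (b := m + 1) (v := permVec (m + 1) w)
          fun i hi => permVec_eq_top le_rfl w hi]
        rw [Fin.val_last, act_insertTop_last rfl (hv m (by omega))]
      | succ r ih =>
        intro hr
        rw [pow_succ, ← mul_assoc, coord_mul_TA k hd (ih (by omega)), Option.bind_some,
          Fin.val_last, act_insertTop_pow rfl (hv m (by omega)) (by omega) hr]
    change coord k hd (TW k (m + 1) d w * TA k (m + 1) d (Fin.last m) ^ (a.val + 1) *
      descA k (m + 1) d b) = optVec k (some (insertTop b (permVec (m + 1) w), a.val + 1))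
    induction b using fin_descending_induction with
    | hlast b hb =>
      rw [descA_last k hb, mul_one, hpow _ (by omega), Nat.succ.inj hb]
    | hstep b c hbc ih =>
      rw [descA_succ k hbc, ← mul_assoc, coord_mul_TA k hd ih, Option.bind_some, ← hbc,
        act_insertTop (by omega) (hv b b.isLt)]

theorem linearIndependent_optVec {ι : Type*} {f : ι → State} (hf : Function.Injective f) :
    LinearIndependent k fun i => optVec k (some (f i)) := by
  have := (Finsupp.basisSingleOne (R := k) (ι := State)).linearIndependent.comp f hf
  simpa [Function.comp_def, optVec] using this

/-- The basis of standard words. -/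
noncomputable def stdBasis {m d : ℕ} (hd : 2 ≤ d) :
    Module.Basis (StdIndex (m + 1) d) k (NCA k (m + 1) d) :=
  Module.Basis.mk (v := stdWord k (m + 1) d (Nat.le_add_left 1 m))
    (LinearIndependent.of_comp (coord k hd) (by
      have := linearIndependent_optVec k (stdState_injective (m + 1) d)
      rwa [← funext (coord_stdWord k hd)] at this))
    (span_stdWord k m d hd).ge

theorem card_stdIndex (n d : ℕ) :
    Nat.card (StdIndex n d) = n.factorial * (1 + n * (d - 1)) := by
  simp only [Nat.card_eq_fintype_card, Fintype.card_sum, Fintype.card_prod, Fintype.card_perm,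
    Fintype.card_fin]
  ring

theorem injective_of_linearIndependent_comp {M N ι : Type*} [AddCommGroup M] [Module k M]
    [AddCommGroup N] [Module k N] {u : ι → M} (hu : Submodule.span k (Set.range u) = ⊤)
    (f : M →ₗ[k] N) (hf : LinearIndependent k (f ∘ u)) : Function.Injective f := by
  rw [injective_iff_map_eq_zero]
  intro x hx
  have hx' : x ∈ Submodule.span k (Set.range u) := hu ▸ Submodule.mem_top
  obtain ⟨c, rfl⟩ := Finsupp.mem_span_range_iff_exists_finsupp.1 hx'
  have : Finsupp.linearCombination k (f ∘ u) c = 0 := by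
    rw [← hx, Finsupp.linearCombination_apply, map_finsuppSum]
    simp
  rw [linearIndependent_iff.1 hf c this, Finsupp.sum_zero_index]

/-- The usual algebra is spanned by products indexed by `S_{l+1}`, and the natural map followed by
`coord` sends these to distinct states; so the map is injective, with image `R_l`. -/
theorem exists_usual_equiv {n d : ℕ} (hd : 2 ≤ d) {l : ℕ} (hl : l < n) :
    ∃ e : UsualNCA k l ≃ₐ[k] R k n d l, ∀ i : Fin l,
      (e (T k (CoxeterMatrix.A l) (fun _ => 2) i) : NCA k n d) = TA k n d (i.castLE hl.le) := by
  have hb : IsBraided fun i : Fin l => TA k n d (i.castLE hl.le) :=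
    ⟨fun _ _ h => TA_braid k h, fun _ _ h => TA_comm k h⟩
  let f : UsualNCA k l →ₐ[k] NCA k n d := liftA k _ hb fun i =>
    TA_sq k (i.castLE hl.le) (by rw [Fin.val_castLE]; omega)
  have hfT : ∀ i, f (T k (CoxeterMatrix.A l) (fun _ => 2) i) = TA k n d (i.castLE hl.le) :=
    fun i => liftA_T k _ _ _ i
  have hspan : Submodule.span k
      (Set.range (permProd (T k (CoxeterMatrix.A l) (fun _ => 2)))) = ⊤ := by
    rw [eq_top_iff, ← Algebra.top_toSubmodule, ← adjoin_range_T k]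
    refine adjoin_range_le_span_permProd k (isBraided_T k l _) fun i => ?_
    rw [← sq]
    exact T_pow k (CoxeterMatrix.A l) (fun _ => 2) i
  have hinj : Function.Injective f := by
    have hc : (coord k hd ∘ₗ f.toLinearMap) ∘ permProd (T k (CoxeterMatrix.A l) (fun _ => 2)) =
        fun w => optVec k (some (permVec n w, 0)) := by
      funext w
      rw [← (exists_isAscendingWord w).choose_spec.coord_prod k hd hl]
      simp only [Function.comp_apply, LinearMap.comp_apply, AlgHom.toLinearMap_apply, permProd,
        map_list_prod, List.map_map]
      congr 3
      exact funext hfT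
    have := injective_of_linearIndependent_comp k hspan (coord k hd ∘ₗ f.toLinearMap) (by
      rw [hc]
      exact linearIndependent_optVec k fun w w' h =>
        permVec_injective n (l + 1) (Prod.ext_iff.1 h).1)
    exact Function.Injective.of_comp (f := coord k hd) this
  have hrange : f.range = R k n d l := by
    rw [← Algebra.map_top, ← adjoin_range_T k, AlgHom.map_adjoin, R]
    congr 1
    ext x
    constructor
    · rintro ⟨_, ⟨i, rfl⟩, rfl⟩
      exact ⟨i.castLE hl.le, i.isLt, (hfT i).symm⟩
    · rintro ⟨i, hi, rfl⟩
      exact ⟨_, ⟨⟨i, hi⟩, rfl⟩, hfT ⟨i, hi⟩⟩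
  exact ⟨(AlgEquiv.ofInjective f hinj).trans (Subalgebra.equivOfEq _ _ hrange), hfT⟩

end Independence

end NilCoxeter

theorem mainTheorem2 (k : Type*) [CommRing k] (n d : ℕ) (hn : 1 ≤ n) (hd : 2 ≤ d) :
    -- the explicit presentation of `NC_A(n,d)`
    (∃ e : NilCoxeter.NCA k n d ≃ₐ[k] RingQuot (NilCoxeter.ExplicitRel k n d),
      ∀ i : Fin n, e (NilCoxeter.TA k n d i) =
        RingQuot.mkAlgHom k (NilCoxeter.ExplicitRel k n d) (FreeAlgebra.ι k i)) ∧
    -- `T_w` does not depend on the reduced word of `w`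
    (∀ (w : Equiv.Perm (Fin n)) (ω : List (Fin (n - 1))), NilCoxeter.IsReducedWord w ω →
      NilCoxeter.wordA k n d ω = NilCoxeter.TW k n d w) ∧
    -- the standard words form a basis, with `n! (1 + n (d - 1))` elements
    Module.Free k (NilCoxeter.NCA k n d) ∧
    (∃ b : Module.Basis (NilCoxeter.StdIndex n d) k (NilCoxeter.NCA k n d),
      ∀ x, b x = NilCoxeter.stdWord k n d hn x) ∧
    Nat.card (NilCoxeter.StdIndex n d) = n.factorial * (1 + n * (d - 1)) ∧
    (Nontrivial k →
      Module.finrank k (NilCoxeter.NCA k n d) = n.factorial * (1 + n * (d - 1))) ∧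
    -- the subalgebra generated by `T_1, …, T_l` is the usual nil-Coxeter algebra of type `A_l`
    (∀ l : ℕ, 1 ≤ l → ∀ hl : l ≤ n - 1,
      ∃ e : NilCoxeter.UsualNCA k l ≃ₐ[k] NilCoxeter.R k n d l,
        ∀ i : Fin l,
          (e (NilCoxeter.T k (CoxeterMatrix.A l) (fun _ => 2) i) : NilCoxeter.NCA k n d) =
            NilCoxeter.TA k n d (i.castLE (hl.trans (Nat.sub_le n 1)))) := by
  obtain ⟨m, rfl⟩ : ∃ m, n = m + 1 := ⟨n - 1, by omega⟩
  refine ⟨NilCoxeter.exists_explicit_presentation k (m + 1) d,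
    fun w ω h => NilCoxeter.wordA_eq_TW k h, .of_basis (NilCoxeter.stdBasis k hd),
    ⟨NilCoxeter.stdBasis k hd, fun x => by simp [NilCoxeter.stdBasis]⟩,
    NilCoxeter.card_stdIndex (m + 1) d, fun _ => ?_,
    fun l _ hl => NilCoxeter.exists_usual_equiv k hd (Nat.lt_succ_of_le hl)⟩
  rw [Module.finrank_eq_nat_card_basis (NilCoxeter.stdBasis k hd), NilCoxeter.card_stdIndex]
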